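/- **Theorem 4.9 (inverse theorem).** Let $\mathbb R^3_H=\{\mathbf t\in\mathbb R^3:\ t_1+t_2+t_3=0\}$, equipped with the measure $d\mathbf t=dt_1\,dt_2$ and with $\|\mathbf t\|=(t_1^2+t_2^2)^{1/2}$, and let $\Omega=\{\mathbf t\in\mathbb R^3_H:\ -1\le t_1,t_2,-t_3<1\}$ be the regular hexagon. A function $f:\mathbb R^3_H\to\mathbb C$ is called $H$-periodic if $f(\mathbf t)=f(\mathbf s)$ whenever $t_1-s_1\equiv t_2-s_2\equiv t_3-s_3 \pmod 3$. For $1\le p<\infty$ let $L^p$ be the space of $H$-periodic functions with $\|f\|_p=\left(\int_\Omega|f(\mathbf t)|^p\,d\mathbf t\right)^{1/p}<\infty$, and for $p=\infty$ let $L^\infty$ denote the space of continuous $H$-periodic functions with $\|f\|_\infty=\sup_{\overline\Omega}|f|$. For $n\ge 0$ put $$\mathcal H_n=\operatorname{span}_{\mathbb C}\left\{\mathbf t\mapsto e^{\frac{2\pi i}{3}\mathbf j\cdot\mathbf t}:\ \mathbf j\in\mathbb Z^3,\ j_1+j_2+j_3=0,\ -n\le j_1,j_2,j_3\le n\right\},\qquad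 E_n(f)_p=\inf_{S\in\mathcal H_n}\|f-S\|_p .$$ Let $\Delta_{\mathbf t}f(\mathbf x)=f(\mathbf x+\mathbf t)-f(\mathbf x)$, let $\Delta^r_{\mathbf t}$ be its $r$-th iterate, and let $\omega_r(f;h)_p=\sup_{\|\mathbf t\|\le h}\|\Delta^r_{\mathbf t}f\|_p$. For each integer $r\ge1$ there exists a constant $c_r$, depending only on $r$, such that for all $1\le p\le\infty$, all $f\in L^p$ (in particular, for every continuous $H$-periodic $f$) and all $h>0$, $$\omega_r(f;h)_p\ \le\ c_r\,h^r\sum_{0\le n\le 1/h}(n+1)^{r-1}E_n(f)_p .$$ -/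

import Mathlib

open MeasureTheory
open scoped NNReal ENNReal

noncomputable section

namespace HexApprox

/-- The plane `t₁ + t₂ + t₃ = 0` in `ℝ³`; its points are the homogeneous coordinates. -/
def Plane : Submodule ℝ (Fin 3 → ℝ) where
  carrier := {t | t 0 + t 1 + t 2 = 0}
  zero_mem' := by simp
  add_mem' := by
    intro a b ha hb
    simp only [Set.mem_ofPred_eq, Pi.add_apply] at *
    linarith
  smul_mem' := by
    intro c a ha
    simp only [Set.mem_ofPred_eq, Pi.smul_apply, smul_eq_mul] at *
    rw [← mul_add, ← mul_add, ha, mul_zero]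

/-- The parametrization of the plane by the first two coordinates. -/
def ofPair (u : ℝ × ℝ) : Plane :=
  ⟨![u.1, u.2, -u.1 - u.2], by
    change u.1 + u.2 + (-u.1 - u.2) = 0
    ring⟩

/-- The measure `dt = dt₁ dt₂` on the plane. -/
def planeMeasure : Measure Plane := (volume : Measure (ℝ × ℝ)).map ofPair

/-- The half-open regular hexagon `-1 ≤ t₁, t₂, -t₃ < 1`. -/
def Omega : Set Plane :=
  {t | (-1 ≤ t.1 0 ∧ t.1 0 < 1) ∧ (-1 ≤ t.1 1 ∧ t.1 1 < 1) ∧ (-1 ≤ -t.1 2 ∧ -t.1 2 < 1)}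

/-- `t ≡ s mod 3`, meaning `t₁ - s₁ ≡ t₂ - s₂ ≡ t₃ - s₃ mod 3`. -/
def HexCongr (t s : Plane) : Prop :=
  (t.1 0 - s.1 0) ≡ (t.1 1 - s.1 1) [PMOD (3 : ℝ)] ∧
    (t.1 1 - s.1 1) ≡ (t.1 2 - s.1 2) [PMOD (3 : ℝ)]

/-- Periodicity with respect to the hexagonal lattice. -/
def HPeriodic (f : Plane → ℂ) : Prop := ∀ t s : Plane, HexCongr t s → f t = f s

/-- The exponential `φ_j(t) = exp ((2πi/3) j · t)`. -/
def phi (j : Fin 3 → ℤ) (t : Plane) : ℂ :=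
  Complex.exp (2 * Real.pi * Complex.I / 3 * (∑ i, (j i : ℝ) * t.1 i : ℝ))

/-- The integer points of the plane with all coordinates in `[-n, n]`. -/
def hexIndex (n : ℕ) : Set (Fin 3 → ℤ) :=
  {j | j 0 + j 1 + j 2 = 0 ∧ ∀ i, -(n : ℤ) ≤ j i ∧ j i ≤ n}

/-- The trigonometric polynomials of degree at most `n` on the hexagon. -/
def trigPoly (n : ℕ) : Submodule ℂ (Plane → ℂ) := Submodule.span ℂ (phi '' hexIndex n)

open Classical in
/-- The norm `‖f‖_p`, as an extended nonnegative number: the integral norm over the hexagon for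
`p < ∞`, the uniform norm on the closed hexagon for `p = ∞`. -/
def hexNorm (p : ℝ≥0∞) (f : Plane → ℂ) : ℝ≥0∞ :=
  if p = ∞ then ⨆ t ∈ closure Omega, ‖f t‖ₑ else eLpNorm f p (planeMeasure.restrict Omega)

/-- The space `L^p` of `H`-periodic functions; for `p = ∞` it consists of the continuous
`H`-periodic functions. -/
def MemHexLp (p : ℝ≥0∞) (f : Plane → ℂ) : Prop :=
  HPeriodic f ∧ (p = ∞ → Continuous f) ∧ (p ≠ ∞ → MemLp f p (planeMeasure.restrict Omega))

/-- The error `E_n(f)_p` of best approximation. -/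
def bestApprox (n : ℕ) (p : ℝ≥0∞) (f : Plane → ℂ) : ℝ≥0∞ :=
  ⨅ S ∈ trigPoly n, hexNorm p (f - S)

/-- The Euclidean norm of `(t₁, t₂)`. -/
def pairNorm (t : Plane) : ℝ := Real.sqrt (t.1 0 ^ 2 + t.1 1 ^ 2)

/-- The modulus of smoothness `ω_r(f; h)_p`. -/
def modulus (r : ℕ) (f : Plane → ℂ) (h : ℝ) (p : ℝ≥0∞) : ℝ≥0∞ :=
  ⨆ (t : Plane) (_ : pairNorm t ≤ h), hexNorm p ((fwdDiff t)^[r] f)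

end HexApprox

end

/-! ### The hexagon as a fundamental domain of the period lattice -/

namespace HexApprox

/-! The engine is a Bernstein inequality for differences: for `S` of degree `n`, `‖Δ_t S‖ ≤ 15 n ‖t‖
‖S‖` in every norm with `p ≥ 1` (`hexNorm_fwdDiff_le`). Its only analytic input is that translations
are isometries of periodic functions, because the hexagon and its translates are fundamental domains
of one lattice. On trigonometric polynomials a translation multiplies the coefficients by
`e^{iθ_j}`, where `θ_j = freq j t` is linear in `t`; hence absolutely convergent combinations of
such factors are bounded multipliers. On `|θ| ≤ σ` the function `θ` agrees with a triangle wave,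
whose Fourier series converges absolutely, so `θ` costs `O(σ)` (`isMultiplier_freq`). Finally
`e^{iθ} - 1` is `iθ` times an average of `e^{isθ}` over `0 ≤ s ≤ 1`, and averages cost at most 1.

The rest is Bernstein's dyadic argument. With near-best `S_n`, split `f` into `f - S_{2^k}`, where
`2^k` is about `1/h`, plus the telescoping sum of `S_{2^{j+1}} - S_{2^j}`. Differences of order `r`
at most multiply the first norm by `2^r`; Bernstein bounds the blocks by multiples of `h^r 2^{jr}
E_{2^j}`. Condensation (`dyadic_sum_le`), using that `E_n` decreases, turns the dyadic sum into the
full one. -/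

theorem plane_coord_two (t : Plane) : t.1 2 = -t.1 0 - t.1 1 := by
  have h : t.1 0 + t.1 1 + t.1 2 = 0 := t.2
  linarith

theorem plane_ext {t s : Plane} (h0 : t.1 0 = s.1 0) (h1 : t.1 1 = s.1 1) : t = s := by
  apply Subtype.ext
  funext i
  fin_cases i
  · exact h0
  · exact h1
  · change t.1 2 = s.1 2
    rw [plane_coord_two t, plane_coord_two s, h0, h1]

theorem continuous_coord (i : Fin 3) : Continuous fun t : Plane => t.1 i :=
  (continuous_apply i).comp continuous_subtype_val

theorem continuous_ofPair : Continuous ofPair := by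
  refine Continuous.subtype_mk (continuous_pi fun i => ?_) _
  fin_cases i
  · exact continuous_fst
  · exact continuous_snd
  · exact (continuous_fst.neg.sub continuous_snd : Continuous fun u : ℝ × ℝ => -u.1 - u.2)

theorem ofPair_add (u v : ℝ × ℝ) : ofPair (u + v) = ofPair u + ofPair v :=
  plane_ext rfl rfl

theorem ofPair_coord (t : Plane) : ofPair (t.1 0, t.1 1) = t :=
  plane_ext rfl rfl

instance : planeMeasure.IsAddLeftInvariant where
  map_add_left_eq_self v := by
    have hm := continuous_ofPair.measurable
    rw [planeMeasure, Measure.map_map (measurable_const_add v) hm]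
    have : (v + ·) ∘ ofPair = ofPair ∘ ((v.1 0, v.1 1) + ·) := by
      funext u
      simp only [Function.comp, ofPair_add, ofPair_coord]
    rw [this, ← Measure.map_map hm (measurable_const_add _), map_add_left_eq_self]

/-- The translations under which `H`-periodic functions are invariant. -/
def hexLattice : AddSubgroup Plane where
  carrier := {t | ∃ a b c : ℤ, t.1 0 = a ∧ t.1 1 = b ∧ a - b = 3 * c}
  zero_mem' := ⟨0, 0, 0, by simp, by simp, by simp⟩
  add_mem' := by
    rintro s t ⟨a, b, c, h0, h1, h⟩ ⟨a', b', c', h0', h1', h'⟩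
    exact ⟨a + a', b + b', c + c', by push_cast; rw [← h0, ← h0']; rfl,
      by push_cast; rw [← h1, ← h1']; rfl, by linarith⟩
  neg_mem' := by
    rintro s ⟨a, b, c, h0, h1, h⟩
    exact ⟨-a, -b, -c, by push_cast; rw [← h0]; rfl, by push_cast; rw [← h1]; rfl, by linarith⟩

/-- The coordinates of `t - s` sum to zero; if they also differ pairwise by multiples of 3, each of
them is forced to be an integer. -/
theorem hexCongr_iff {t s : Plane} : HexCongr t s ↔ t - s ∈ hexLattice := by
  have e : ∀ i, (t - s).1 i = t.1 i - s.1 i := fun _ => rfl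
  have h2 := plane_coord_two (t - s)
  simp only [HexCongr, ← e, AddCommGroup.modEq_iff_zsmul, zsmul_eq_mul]
  change _ ↔ ∃ a b c : ℤ, (t - s).1 0 = a ∧ (t - s).1 1 = b ∧ a - b = 3 * c
  generalize (t - s).1 0 = x0, (t - s).1 1 = x1, (t - s).1 2 = x2 at h2 ⊢
  constructor
  · rintro ⟨⟨m, hm⟩, ⟨n, hn⟩⟩
    refine ⟨-2 * m - n, m - n, -m, ?_, ?_, by ring⟩ <;> push_cast <;> linarith
  · rintro ⟨a, b, c, h0, h1, h⟩
    have h' : (a : ℝ) - b = 3 * c := by exact_mod_cast h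
    exact ⟨⟨-c, by push_cast; linarith⟩, ⟨-c - b, by push_cast; linarith⟩⟩

theorem HPeriodic.vadd_eq {f : Plane → ℂ} (hf : HPeriodic f) (g : hexLattice) (x : Plane) :
    f (g +ᵥ x) = f x := by
  apply hf
  rw [hexCongr_iff]
  convert g.2 using 1
  exact add_sub_cancel_right _ _

instance : Countable hexLattice := by
  refine Function.Injective.countable (β := ℤ × ℤ)
    (f := fun g => (⌊(g : Plane).1 0⌋, ⌊(g : Plane).1 1⌋)) ?_
  rintro ⟨s, hs⟩ ⟨t, ht⟩ h
  obtain ⟨a, b, c, h0, h1, -⟩ := id hs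
  obtain ⟨a', b', c', h0', h1', -⟩ := id ht
  simp only [h0, h1, h0', h1', Int.floor_intCast, Prod.mk.injEq] at h
  exact Subtype.ext (plane_ext (by rw [h0, h0', h.1]) (by rw [h1, h1', h.2]))

theorem mem_Omega_iff {t : Plane} : t ∈ Omega ↔ (-1 ≤ t.1 0 ∧ t.1 0 < 1) ∧
    (-1 ≤ t.1 1 ∧ t.1 1 < 1) ∧ (-1 ≤ t.1 0 + t.1 1 ∧ t.1 0 + t.1 1 < 1) := by
  have : -t.1 2 = t.1 0 + t.1 1 := by rw [plane_coord_two t]; ring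
  simp only [Omega, Set.mem_ofPred_eq, this]

theorem exists_vadd_mem_Omega (x : Plane) : ∃ g : hexLattice, g +ᵥ x ∈ Omega := by
  have key : ∀ a b c : ℤ, a - b = 3 * c → (-1 ≤ a + x.1 0 ∧ a + x.1 0 < 1) →
      (-1 ≤ b + x.1 1 ∧ b + x.1 1 < 1) →
      (-1 ≤ (a + x.1 0) + (b + x.1 1) ∧ (a + x.1 0) + (b + x.1 1) < 1) →
      ∃ g : hexLattice, g +ᵥ x ∈ Omega := by
    intro a b c h h0 h1 h2
    exact ⟨⟨ofPair (a, b), a, b, c, rfl, rfl, h⟩, mem_Omega_iff.2 ⟨h0, h1, h2⟩⟩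
  have hu := Int.floor_le (x.1 0)
  have hu' := Int.lt_floor_add_one (x.1 0)
  have hv := Int.floor_le (x.1 1)
  have hv' := Int.lt_floor_add_one (x.1 1)
  set a := ⌊x.1 0⌋
  set b := ⌊x.1 1⌋
  -- Removing the integer parts leaves a point of the unit square. The residue of `a - b` mod 3
  -- dictates which coordinates are lowered by a further 1 to land in the lattice; for residue 0 the
  -- diagonal `u + v = 1` decides between none and both.
  obtain ⟨c, h | h | h⟩ : ∃ c : ℤ, a - b = 3 * c ∨ a - b = 3 * c + 1 ∨ a - b = 3 * c + 2 :=
    ⟨(a - b) / 3, by omega⟩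
  · by_cases hs : x.1 0 - a + (x.1 1 - b) < 1
    · refine key (-a) (-b) (-c) (by linarith) ?_ ?_ ?_ <;> push_cast <;>
        constructor <;> linarith
    · refine key (-a - 1) (-b - 1) (-c) (by linarith) ?_ ?_ ?_ <;> push_cast <;>
        constructor <;> linarith
  · refine key (-a) (-b - 1) (-c) (by linarith) ?_ ?_ ?_ <;> push_cast <;>
        constructor <;> linarith
  · refine key (-a - 1) (-b) (-c - 1) (by linarith) ?_ ?_ ?_ <;> push_cast <;>
        constructor <;> linarith

theorem vadd_mem_Omega_unique {x : Plane} {g g' : hexLattice} (h : g +ᵥ x ∈ Omega)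
    (h' : g' +ᵥ x ∈ Omega) : g = g' := by
  obtain ⟨s, hs⟩ := g
  obtain ⟨t, ht⟩ := g'
  obtain ⟨a, b, c, e0, e1, e⟩ := id hs
  obtain ⟨a', b', c', e0', e1', e'⟩ := id ht
  obtain ⟨⟨h1, h2⟩, ⟨h3, h4⟩, h5, h6⟩ : (-1 ≤ s.1 0 + x.1 0 ∧ s.1 0 + x.1 0 < 1) ∧
    (-1 ≤ s.1 1 + x.1 1 ∧ s.1 1 + x.1 1 < 1) ∧
    (-1 ≤ (s.1 0 + x.1 0) + (s.1 1 + x.1 1) ∧ (s.1 0 + x.1 0) + (s.1 1 + x.1 1) < 1) :=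
      mem_Omega_iff.1 h
  obtain ⟨⟨h1', h2'⟩, ⟨h3', h4'⟩, h5', h6'⟩ : (-1 ≤ t.1 0 + x.1 0 ∧ t.1 0 + x.1 0 < 1) ∧
    (-1 ≤ t.1 1 + x.1 1 ∧ t.1 1 + x.1 1 < 1) ∧
    (-1 ≤ (t.1 0 + x.1 0) + (t.1 1 + x.1 1) ∧ (t.1 0 + x.1 0) + (t.1 1 + x.1 1) < 1) :=
      mem_Omega_iff.1 h'
  rw [e0] at h1 h2 h5 h6
  rw [e1] at h3 h4 h5 h6
  rw [e0'] at h1' h2' h5' h6'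
  rw [e1'] at h3' h4' h5' h6'
  -- The integer differences `d₀`, `d₁` and `d₀ + d₁` all lie in `{-1, 0, 1}`. Since 3 divides `d₀ -
  -- d₁`, this forces `d₀ = d₁`, and then both vanish.
  have i1 : a - a' < 2 := by exact_mod_cast (by linarith : (a : ℝ) - a' < 2)
  have i2 : a' - a < 2 := by exact_mod_cast (by linarith : (a' : ℝ) - a < 2)
  have i3 : b - b' < 2 := by exact_mod_cast (by linarith : (b : ℝ) - b' < 2)
  have i4 : b' - b < 2 := by exact_mod_cast (by linarith : (b' : ℝ) - b < 2)
  have i5 : a + b - (a' + b') < 2 := by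
    exact_mod_cast (by linarith : (a : ℝ) + b - (a' + b') < 2)
  have i6 : a' + b' - (a + b) < 2 := by
    exact_mod_cast (by linarith : (a' : ℝ) + b' - (a + b) < 2)
  exact Subtype.ext (plane_ext (e0.trans (.trans (by congr 1; omega) e0'.symm))
    (e1.trans (.trans (by congr 1; omega) e1'.symm)))

theorem measurableSet_Omega : MeasurableSet Omega := by
  have m : ∀ i, Measurable fun t : Plane => t.1 i := fun i => (continuous_coord i).measurable
  refine MeasurableSet.inter ?_ (MeasurableSet.inter ?_ ?_)
  · exact (measurableSet_le measurable_const (m 0)).inter (measurableSet_lt (m 0) measurable_const)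
  · exact (measurableSet_le measurable_const (m 1)).inter (measurableSet_lt (m 1) measurable_const)
  · exact (measurableSet_le measurable_const (m 2).neg).inter
      (measurableSet_lt (m 2).neg measurable_const)

/-- A translation does not preserve the hexagon, but it carries this shifted domain onto it.
Periodic functions have equal integrals over both domains, which makes the norms translation
invariant. -/
theorem isAddFundamentalDomain_Omega_translate (v : Plane) :
    IsAddFundamentalDomain hexLattice ((v + ·) ⁻¹' Omega) planeMeasure := by
  refine .mk' (measurable_const_add v measurableSet_Omega).nullMeasurableSet fun x => ?_
  have e : ∀ g : hexLattice, g +ᵥ x ∈ (v + ·) ⁻¹' Omega ↔ g +ᵥ (v + x) ∈ Omega := by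
    intro g
    have : v + (g +ᵥ x) = g +ᵥ (v + x) := add_left_comm v (g : Plane) x
    rw [Set.mem_preimage, this]
  obtain ⟨g, hg⟩ := exists_vadd_mem_Omega (v + x)
  exact ⟨g, (e g).2 hg, fun g' hg' => vadd_mem_Omega_unique ((e g').1 hg') hg⟩

theorem isAddFundamentalDomain_Omega :
    IsAddFundamentalDomain hexLattice Omega planeMeasure := by
  simpa using isAddFundamentalDomain_Omega_translate 0

theorem planeMeasure_Omega_lt_top : planeMeasure Omega < ∞ := by
  rw [planeMeasure, Measure.map_apply continuous_ofPair.measurable measurableSet_Omega]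
  refine lt_of_le_of_lt (measure_mono (t := Set.Icc (-1 : ℝ) 1 ×ˢ Set.Icc (-1 : ℝ) 1) ?_)
    (isCompact_Icc.prod isCompact_Icc).measure_lt_top
  rintro u ⟨⟨h1, h2⟩, ⟨h3, h4⟩, -⟩
  exact ⟨⟨h1, h2.le⟩, h3, h4.le⟩

instance : IsFiniteMeasure (planeMeasure.restrict Omega) :=
  ⟨by rw [Measure.restrict_apply_univ]; exact planeMeasure_Omega_lt_top⟩

theorem measurePreserving_add_left_restrict (v : Plane) :
    MeasurePreserving (v + ·) (planeMeasure.restrict ((v + ·) ⁻¹' Omega))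
      (planeMeasure.restrict Omega) :=
  (measurePreserving_add_left planeMeasure v).restrict_preimage measurableSet_Omega


/-! ### Translation invariance of the norms, and the exponentials -/

variable {p : ℝ≥0∞} {f g : Plane → ℂ}

/-- Translation of a function on the plane. -/
def translate (v : Plane) (f : Plane → ℂ) : Plane → ℂ := fun x => f (v + x)

theorem HPeriodic.translate (hf : HPeriodic f) (v : Plane) : HPeriodic (translate v f) := by
  intro t s h
  apply hf
  rw [hexCongr_iff] at *
  rwa [add_sub_add_left_eq_sub]

theorem eLpNorm_restrict_eq {s t : Set Plane} (hs : IsAddFundamentalDomain hexLattice s planeMeasure)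
    (ht : IsAddFundamentalDomain hexLattice t planeMeasure) (hf : HPeriodic f)
    (hp0 : p ≠ 0) (hp : p ≠ ∞) :
    eLpNorm f p (planeMeasure.restrict s) = eLpNorm f p (planeMeasure.restrict t) := by
  rw [eLpNorm_eq_lintegral_rpow_enorm_toReal hp0 hp, eLpNorm_eq_lintegral_rpow_enorm_toReal hp0 hp,
    hs.setLIntegral_eq ht]
  intro g x
  rw [hf.vadd_eq]

theorem aestronglyMeasurable_translate (hf : HPeriodic f)
    (hm : AEStronglyMeasurable f (planeMeasure.restrict Omega)) (v : Plane) :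
    AEStronglyMeasurable (translate v f) (planeMeasure.restrict Omega) := by
  rw [isAddFundamentalDomain_Omega.aestronglyMeasurable_on_iff
    (isAddFundamentalDomain_Omega_translate v) (hf.translate v).vadd_eq]
  exact hm.comp_measurePreserving (measurePreserving_add_left_restrict v)

theorem eLpNorm_translate (hf : HPeriodic f)
    (hm : AEStronglyMeasurable f (planeMeasure.restrict Omega)) (v : Plane)
    (hp0 : p ≠ 0) (hp : p ≠ ∞) :
    eLpNorm (translate v f) p (planeMeasure.restrict Omega) =
      eLpNorm f p (planeMeasure.restrict Omega) := by
  rw [eLpNorm_restrict_eq isAddFundamentalDomain_Omega (isAddFundamentalDomain_Omega_translate v)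
    (hf.translate v) hp0 hp]
  exact eLpNorm_comp_measurePreserving hm (measurePreserving_add_left_restrict v)

theorem hexNorm_top (f : Plane → ℂ) : hexNorm ∞ f = ⨆ t ∈ closure Omega, ‖f t‖ₑ := if_pos rfl

theorem hexNorm_of_ne_top (hp : p ≠ ∞) (f : Plane → ℂ) :
    hexNorm p f = eLpNorm f p (planeMeasure.restrict Omega) := if_neg hp

theorem hexNorm_top_of_periodic (hf : HPeriodic f) : hexNorm ∞ f = ⨆ t, ‖f t‖ₑ := by
  rw [hexNorm_top]
  refine le_antisymm (iSup_mono fun t => iSup_le fun _ => le_rfl) (iSup_le fun t => ?_)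
  obtain ⟨g, hg⟩ := exists_vadd_mem_Omega t
  rw [← hf.vadd_eq g t]
  exact le_iSup₂ (f := fun t (_ : t ∈ closure Omega) => ‖f t‖ₑ) _ (subset_closure hg)

theorem MemHexLp.translate (hf : MemHexLp p f) (hp1 : 1 ≤ p) (v : Plane) :
    MemHexLp p (translate v f) := by
  refine ⟨hf.1.translate v, fun h => (hf.2.1 h).comp (continuous_const_add v), fun h => ?_⟩
  have hm := hf.2.2 h
  refine ⟨aestronglyMeasurable_translate hf.1 hm.1 v, ?_⟩
  rw [eLpNorm_translate hf.1 hm.1 v (zero_lt_one.trans_le hp1).ne' h]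
  exact hm.2

theorem hexNorm_translate (hf : MemHexLp p f) (hp1 : 1 ≤ p) (v : Plane) :
    hexNorm p (translate v f) = hexNorm p f := by
  by_cases h : p = ∞
  · subst h
    rw [hexNorm_top_of_periodic hf.1, hexNorm_top_of_periodic (hf.1.translate v)]
    exact (Equiv.addLeft v).iSup_comp (g := fun t => ‖f t‖ₑ)
  · rw [hexNorm_of_ne_top h, hexNorm_of_ne_top h]
    exact eLpNorm_translate hf.1 (hf.2.2 h).1 v (zero_lt_one.trans_le hp1).ne' h

theorem MemHexLp.add (hf : MemHexLp p f) (hg : MemHexLp p g) : MemHexLp p (f + g) :=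
  ⟨fun t s h => by rw [Pi.add_apply, Pi.add_apply, hf.1 t s h, hg.1 t s h],
    fun h => (hf.2.1 h).add (hg.2.1 h), fun h => (hf.2.2 h).add (hg.2.2 h)⟩

theorem MemHexLp.const_smul (hf : MemHexLp p f) (c : ℂ) : MemHexLp p (c • f) :=
  ⟨fun t s h => by rw [Pi.smul_apply, Pi.smul_apply, hf.1 t s h],
    fun h => (hf.2.1 h).const_smul c, fun h => (hf.2.2 h).const_smul c⟩

theorem MemHexLp.zero : MemHexLp p 0 :=
  ⟨fun _ _ _ => rfl, fun _ => continuous_const, fun _ => MemLp.zero⟩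

theorem hexNorm_add_le (hf : MemHexLp p f) (hg : MemHexLp p g) (hp1 : 1 ≤ p) :
    hexNorm p (f + g) ≤ hexNorm p f + hexNorm p g := by
  by_cases h : p = ∞
  · subst h
    simp only [hexNorm_top]
    refine iSup₂_le fun t ht => (enorm_add_le _ _).trans ?_
    exact add_le_add (le_iSup₂ (f := fun t (_ : t ∈ closure Omega) => ‖f t‖ₑ) t ht)
      (le_iSup₂ (f := fun t (_ : t ∈ closure Omega) => ‖g t‖ₑ) t ht)
  · simp only [hexNorm_of_ne_top h]
    exact eLpNorm_add_le (hf.2.2 h).1 (hg.2.2 h).1 hp1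

theorem hexNorm_const_smul (c : ℂ) (f : Plane → ℂ) : hexNorm p (c • f) = ‖c‖ₑ * hexNorm p f := by
  by_cases h : p = ∞
  · subst h
    simp only [hexNorm_top, Pi.smul_apply, enorm_smul, ENNReal.mul_iSup]
  · simp only [hexNorm_of_ne_top h, eLpNorm_const_smul]

theorem hexNorm_zero : hexNorm p 0 = 0 := by
  simpa using hexNorm_const_smul (p := p) 0 0

/-- The angular frequency of `s ↦ φ_j (s t)`. -/
noncomputable def freq (j : Fin 3 → ℤ) (t : Plane) : ℝ := 2 * Real.pi / 3 * ∑ i, (j i : ℝ) * t.1 i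

theorem phi_eq (j : Fin 3 → ℤ) (t : Plane) : phi j t = Complex.exp (freq j t * Complex.I) := by
  rw [phi, freq]
  congr 1
  push_cast
  ring

theorem freq_add (j : Fin 3 → ℤ) (t s : Plane) : freq j (t + s) = freq j t + freq j s := by
  simp only [freq, Submodule.coe_add, Pi.add_apply, mul_add, Finset.sum_add_distrib]

theorem freq_smul (j : Fin 3 → ℤ) (a : ℝ) (t : Plane) : freq j (a • t) = a * freq j t := by
  simp only [freq, Submodule.coe_smul, Pi.smul_apply, smul_eq_mul, Finset.mul_sum]
  exact Finset.sum_congr rfl fun i _ => by ring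

theorem phi_add (j : Fin 3 → ℤ) (t s : Plane) : phi j (t + s) = phi j t * phi j s := by
  rw [phi_eq, phi_eq, phi_eq, freq_add, ← Complex.exp_add]
  push_cast
  ring_nf

theorem continuous_phi (j : Fin 3 → ℤ) : Continuous (phi j) := by
  have : Continuous fun t : Plane => ∑ i, (j i : ℝ) * t.1 i :=
    continuous_finsetSum _ fun i _ => continuous_const.mul (continuous_coord i)
  exact Complex.continuous_exp.comp (continuous_const.mul (Complex.continuous_ofReal.comp this))

theorem enorm_phi (j : Fin 3 → ℤ) (t : Plane) : ‖phi j t‖ₑ = 1 := by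
  rw [phi_eq, ← ofReal_norm, Complex.norm_exp_ofReal_mul_I, ENNReal.ofReal_one]

theorem hPeriodic_phi {j : Fin 3 → ℤ} (hj : j 0 + j 1 + j 2 = 0) : HPeriodic (phi j) := by
  intro t s h
  obtain ⟨a, b, c, h0, h1, h2⟩ := hexCongr_iff.1 h
  have e : phi j (t - s) = 1 := by
    rw [phi_eq, Complex.exp_eq_one_iff]
    -- The witness is `j · (t - s) / 3` after eliminating `j 2`, the third coordinate and `a = b +
    -- 3c`.
    refine ⟨j 0 * (b + 2 * c) + j 1 * (b + c), ?_⟩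
    have ha : (a : ℝ) = b + 3 * c := by exact_mod_cast (by linarith : a = b + 3 * c)
    have hj2 : (j 2 : ℝ) = -j 0 - j 1 := by exact_mod_cast (by linarith : j 2 = -j 0 - j 1)
    have hs : freq j (t - s) = 2 * Real.pi * (j 0 * (b + 2 * c) + j 1 * (b + c)) := by
      rw [freq, Fin.sum_univ_three, plane_coord_two, h0, h1, hj2, ha]
      ring
    rw [hs]
    push_cast
    ring
  rw [← sub_add_cancel t s, phi_add, e, one_mul]

theorem memHexLp_phi {j : Fin 3 → ℤ} (hj : j 0 + j 1 + j 2 = 0) : MemHexLp p (phi j) :=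
  ⟨hPeriodic_phi hj, fun _ => continuous_phi j, fun _ => MemLp.of_bound
    (continuous_phi j).aestronglyMeasurable 1 (.of_forall fun t => by
      rw [phi_eq, Complex.norm_exp_ofReal_mul_I])⟩

theorem hexNorm_phi_lt_top {j : Fin 3 → ℤ} (hj : j 0 + j 1 + j 2 = 0) : hexNorm p (phi j) < ∞ := by
  by_cases h : p = ∞
  · subst h
    rw [hexNorm_top]
    exact lt_of_le_of_lt (iSup₂_le fun t _ => (enorm_phi j t).le) ENNReal.one_lt_top
  · rw [hexNorm_of_ne_top h]
    exact ((memHexLp_phi hj).2.2 h).2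

end HexApprox

/-! ### Fourier multipliers on trigonometric polynomials -/

open Filter Topology

namespace HexApprox

variable {p : ℝ≥0∞} {F : Finset (Fin 3 → ℤ)} {m m' : (Fin 3 → ℤ) → ℂ} {K K' : ℝ≥0∞}

/-- The trigonometric polynomial with coefficients `c` and frequencies in `F`. -/
noncomputable def expSum (F : Finset (Fin 3 → ℤ)) (c : (Fin 3 → ℤ) → ℂ) : Plane → ℂ :=
  ∑ j ∈ F, c j • phi j

theorem expSum_add (c d : (Fin 3 → ℤ) → ℂ) : expSum F (c + d) = expSum F c + expSum F d := by
  simp only [expSum, Pi.add_apply, add_smul, Finset.sum_add_distrib]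

theorem expSum_smul (a : ℂ) (c : (Fin 3 → ℤ) → ℂ) : expSum F (a • c) = a • expSum F c := by
  simp only [expSum, Pi.smul_apply, smul_assoc, Finset.smul_sum]

theorem expSum_zero : expSum F 0 = 0 := by
  simp only [expSum, Pi.zero_apply, zero_smul, Finset.sum_const_zero]

/-- `F` consists of frequencies in the plane `j₁ + j₂ + j₃ = 0`. -/
def InPlane (F : Finset (Fin 3 → ℤ)) : Prop := ∀ j ∈ F, j 0 + j 1 + j 2 = 0

theorem memHexLp_expSum (hF : InPlane F) (c : (Fin 3 → ℤ) → ℂ) : MemHexLp p (expSum F c) :=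
  Finset.sum_induction _ (MemHexLp p) (fun _ _ => MemHexLp.add) .zero
    fun j hj => (memHexLp_phi (hF j hj)).const_smul _

theorem hexNorm_expSum_le (hF : InPlane F) (hp1 : 1 ≤ p) (c : (Fin 3 → ℤ) → ℂ) :
    hexNorm p (expSum F c) ≤ ∑ j ∈ F, ‖c j‖ₑ * hexNorm p (phi j) := by
  refine (Finset.le_sum_of_subadditive_on_pred (hexNorm p) (MemHexLp p) hexNorm_zero.le
    (fun _ _ hf hg => hexNorm_add_le hf hg hp1) (fun _ _ => MemHexLp.add) _
    fun j hj => (memHexLp_phi (hF j hj)).const_smul _).trans_eq ?_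
  simp only [hexNorm_const_smul]

/-- Multiplying the coefficients of a trigonometric polynomial by `m` increases its norm at most
by the factor `K`. -/
def IsMultiplier (p : ℝ≥0∞) (F : Finset (Fin 3 → ℤ)) (K : ℝ≥0∞) (m : (Fin 3 → ℤ) → ℂ) : Prop :=
  ∀ c, hexNorm p (expSum F (m * c)) ≤ K * hexNorm p (expSum F c)

namespace IsMultiplier

theorem mono (h : IsMultiplier p F K m) (hK : K ≤ K') : IsMultiplier p F K' m :=
  fun c => (h c).trans (mul_le_mul_left hK _)

theorem zero : IsMultiplier p F 0 0 := fun c => by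
  rw [zero_mul, expSum_zero, hexNorm_zero, zero_mul]

theorem add (hF : InPlane F) (hp1 : 1 ≤ p) (h : IsMultiplier p F K m)
    (h' : IsMultiplier p F K' m') : IsMultiplier p F (K + K') (m + m') := fun c => by
  rw [add_mul, add_mul, expSum_add]
  exact (hexNorm_add_le (memHexLp_expSum hF _) (memHexLp_expSum hF _) hp1).trans
    (add_le_add (h c) (h' c))

theorem const_smul (h : IsMultiplier p F K m) (a : ℂ) : IsMultiplier p F (‖a‖ₑ * K) (a • m) :=
  fun c => by
    rw [smul_mul_assoc, expSum_smul, hexNorm_const_smul, mul_assoc]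
    gcongr
    exact h c

theorem mul (h : IsMultiplier p F K m) (h' : IsMultiplier p F K' m') :
    IsMultiplier p F (K * K') (m * m') := fun c => by
  rw [mul_assoc, mul_assoc]
  exact (h _).trans (mul_le_mul_right (h' c) _)

theorem sum (hF : InPlane F) (hp1 : 1 ≤ p) {ι : Type*} (s : Finset ι) {L : ι → ℝ≥0∞}
    {μ : ι → (Fin 3 → ℤ) → ℂ} (h : ∀ i ∈ s, IsMultiplier p F (L i) (μ i)) :
    IsMultiplier p F (∑ i ∈ s, L i) (∑ i ∈ s, μ i) := by
  classical
  induction s using Finset.induction_on with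
  | empty => exact zero
  | insert a s ha ih =>
    rw [Finset.sum_insert ha, Finset.sum_insert ha]
    exact add hF hp1 (h a (Finset.mem_insert_self a s))
      (ih fun i hi => h i (Finset.mem_insert_of_mem hi))

/-- This multiplier is translation by `v`, an isometry. -/
theorem exp_freq (hF : InPlane F) (hp1 : 1 ≤ p) (v : Plane) :
    IsMultiplier p F 1 fun j => Complex.exp (freq j v * Complex.I) := fun c => by
  have : expSum F ((fun j => Complex.exp (freq j v * Complex.I)) * c) =
      translate v (expSum F c) := by
    funext x
    simp only [translate, expSum, Finset.sum_apply, Pi.smul_apply, phi_add, ← phi_eq, Pi.mul_apply,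
      smul_eq_mul]
    exact Finset.sum_congr rfl fun j _ => by ring
  rw [this, hexNorm_translate (memHexLp_expSum hF _) hp1, one_mul]

/-- Only finitely many frequencies occur and each exponential has finite norm, so pointwise
convergence of the multipliers gives convergence in norm. -/
theorem of_tendsto (hF : InPlane F) (hp1 : 1 ≤ p) {μ : ℕ → (Fin 3 → ℤ) → ℂ}
    (h : ∀ n, IsMultiplier p F K (μ n)) (hμ : ∀ j ∈ F, Tendsto (μ · j) atTop (𝓝 (m j))) :
    IsMultiplier p F K m := fun c => by
  have hb : ∀ n, hexNorm p (expSum F (m * c)) ≤ K * hexNorm p (expSum F c) +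
      ∑ j ∈ F, ‖m j - μ n j‖ₑ * ‖c j‖ₑ * hexNorm p (phi j) := fun n => by
    have e : m * c = μ n * c + (m - μ n) * c := by ring
    rw [e, expSum_add]
    refine (hexNorm_add_le (memHexLp_expSum hF _) (memHexLp_expSum hF _) hp1).trans
      (add_le_add (h n c) ((hexNorm_expSum_le hF hp1 _).trans_eq ?_))
    simp only [Pi.mul_apply, Pi.sub_apply, enorm_mul]
  refine ge_of_tendsto' (x := atTop) ?_ hb
  have : Tendsto (fun n => ∑ j ∈ F, ‖m j - μ n j‖ₑ * ‖c j‖ₑ * hexNorm p (phi j)) atTop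
      (𝓝 (∑ j ∈ F, 0 * ‖c j‖ₑ * hexNorm p (phi j))) := by
    refine tendsto_finsetSum _ fun j hj => ?_
    refine ENNReal.Tendsto.mul_const (ENNReal.Tendsto.mul_const ?_ (.inr enorm_ne_top))
      (.inr (hexNorm_phi_lt_top (hF j hj)).ne)
    have := ((tendsto_const_nhds (x := m j)).sub (hμ j hj)).enorm
    simpa using this
  simpa using tendsto_const_nhds.add this

theorem congr (h : IsMultiplier p F K m) (e : ∀ j ∈ F, m j = m' j) : IsMultiplier p F K m' :=
  fun c => by
    have : expSum F (m' * c) = expSum F (m * c) :=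
      Finset.sum_congr rfl fun j hj => by rw [Pi.mul_apply, Pi.mul_apply, e j hj]
    rw [this]
    exact h c

theorem cos_freq (hF : InPlane F) (hp1 : 1 ≤ p) (v : Plane) (a : ℝ) :
    IsMultiplier p F 1 fun j => (Real.cos (freq j v + a) : ℂ) := by
  have h1 := (exp_freq hF hp1 v).const_smul (2⁻¹ * Complex.exp (a * Complex.I))
  have h2 := (exp_freq hF hp1 ((-1 : ℝ) • v)).const_smul (2⁻¹ * Complex.exp ((-a : ℝ) * Complex.I))
  refine ((h1.add hF hp1 h2).congr fun j _ => ?_).mono ?_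
  · simp only [Pi.add_apply, Pi.smul_apply, smul_eq_mul, mul_assoc, ← Complex.exp_add, freq_smul]
    rw [Complex.ofReal_cos, Complex.cos]
    push_cast
    ring_nf
  · rw [enorm_mul, enorm_mul, ← ofReal_norm (Complex.exp _), ← ofReal_norm (Complex.exp _),
      Complex.norm_exp_ofReal_mul_I, Complex.norm_exp_ofReal_mul_I]
    simp only [ENNReal.ofReal_one, mul_one]
    rw [enorm_inv two_ne_zero]
    have : ‖(2 : ℂ)‖ₑ = 2 := by rw [← ofReal_norm]; simp
    rw [this, ENNReal.inv_two_add_inv_two]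

end IsMultiplier

/-! ### The multipliers `θ` and `e^{iθ} - 1` on bounded frequencies -/

/-- The second cosine cancels the even harmonics of the first. On the Bernoulli side, the
combination `B₂(x) - B₂(2x)/4` loses its quadratic term and becomes affine. -/
theorem hasSum_triangle_wave {x : ℝ} (hx : x ∈ Set.Icc (0 : ℝ) (1 / 2)) :
    HasSum (fun n : ℕ => 1 / (n : ℝ) ^ 2 * Real.cos (2 * Real.pi * n * x) +
      -(1 / 4) * (1 / (n : ℝ) ^ 2 * Real.cos (2 * Real.pi * n * (2 * x))))
      (Real.pi ^ 2 * (1 / 8 - x / 2)) := by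
  have h1 := hasSum_one_div_nat_pow_mul_cos one_ne_zero (x := x)
    ⟨hx.1, hx.2.trans (by norm_num)⟩
  have h2 := hasSum_one_div_nat_pow_mul_cos one_ne_zero (x := 2 * x)
    ⟨by linarith [hx.1], by linarith [hx.2]⟩
  have hb : ∀ y : ℝ, (Polynomial.map (algebraMap ℚ ℝ) (Polynomial.bernoulli 2)).eval y =
      y ^ 2 - y + 1 / 6 := fun y => by
    simp [Polynomial.bernoulli, Finset.sum_range_succ, bernoulli_two, bernoulli_one]
    ring
  simp only [mul_one, hb] at h1 h2
  convert h1.add (h2.mul_left (-(1 / 4))) using 1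
  norm_num [Nat.factorial]
  ring

theorem tendsto_nat_mul_exp_sub_one (z : ℂ) :
    Tendsto (fun n : ℕ => (n : ℂ) * (Complex.exp (z / n) - 1)) atTop (𝓝 z) := by
  rw [tendsto_iff_norm_sub_tendsto_zero]
  refine squeeze_zero' (.of_forall fun _ => norm_nonneg _) (g := fun n : ℕ => ‖z‖ ^ 2 / n) ?_
    (tendsto_const_nhds.div_atTop tendsto_natCast_atTop_atTop)
  filter_upwards [eventually_ge_atTop ⌈‖z‖⌉₊, eventually_gt_atTop 0] with n hn hn0
  have hn' : (0 : ℝ) < n := by exact_mod_cast hn0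
  have hnc : (n : ℂ) ≠ 0 := by exact_mod_cast hn0.ne'
  have hz : ‖z / n‖ = ‖z‖ / n := by rw [norm_div, Complex.norm_natCast]
  have h := Complex.norm_exp_sub_one_sub_id_le (x := z / n)
    (by rw [hz, div_le_one hn']; exact Nat.ceil_le.1 hn)
  have e : (n : ℂ) * (Complex.exp (z / n) - 1) - z =
      n * (Complex.exp (z / n) - 1 - z / n) := by field_simp
  rw [e, norm_mul, Complex.norm_natCast]
  refine (mul_le_mul_of_nonneg_left h hn'.le).trans_eq ?_
  rw [hz]
  field_simp

/-- A Riemann-sum form of `iθ ∫₀¹ e^{isθ} ds = e^{iθ} - 1`. With `q = e^{iθ/n}` and `A` the average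
of its powers, the geometric sum gives exactly `n(q - 1)A = e^{iθ} - 1`. As `‖A‖ ≤ 1`, the error is
at most `|n(q - 1) - iθ|`. -/
theorem tendsto_mul_average_exp (θ : ℝ) :
    Tendsto (fun n : ℕ => (θ * Complex.I) *
      ∑ k ∈ Finset.range n, (n : ℂ)⁻¹ * Complex.exp (((k / n : ℝ) * θ : ℝ) * Complex.I)) atTop
      (𝓝 (Complex.exp (θ * Complex.I) - 1)) := by
  rw [tendsto_iff_norm_sub_tendsto_zero]
  have h := tendsto_iff_norm_sub_tendsto_zero.1 (tendsto_nat_mul_exp_sub_one (θ * Complex.I))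
  refine squeeze_zero' (.of_forall fun _ => norm_nonneg _) ?_ h
  filter_upwards [eventually_gt_atTop 0] with n hn
  have hnc : (n : ℂ) ≠ 0 := by exact_mod_cast hn.ne'
  set q := Complex.exp (θ * Complex.I / n) with hq
  have hk : ∀ k : ℕ, Complex.exp (((k / n : ℝ) * θ : ℝ) * Complex.I) = q ^ k := fun k => by
    rw [hq, ← Complex.exp_nat_mul]
    congr 1
    push_cast
    ring
  have hqn : q ^ n = Complex.exp (θ * Complex.I) := by
    rw [hq, ← Complex.exp_nat_mul]
    congr 1
    field_simp
  have hq1 : ‖q‖ = 1 := by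
    have : θ * Complex.I / n = ((θ / n : ℝ) : ℂ) * Complex.I := by push_cast; ring
    rw [hq, this, Complex.norm_exp_ofReal_mul_I]
  set A := ∑ k ∈ Finset.range n, (n : ℂ)⁻¹ * q ^ k with hA
  have hAn : ‖A‖ ≤ 1 := by
    refine (norm_sum_le _ _).trans_eq ?_
    simp [hq1, hn.ne']
  have hgeom : n * (q - 1) * A = Complex.exp (θ * Complex.I) - 1 := by
    rw [← hqn, ← geom_sum_mul, hA, ← Finset.mul_sum]
    field_simp
  simp only [hk]
  rw [← hgeom]
  have : θ * Complex.I * A - n * (q - 1) * A = -((n * (q - 1) - θ * Complex.I) * A) := by ring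
  rw [this, norm_neg, norm_mul]
  exact mul_le_of_le_one_right (norm_nonneg _) hAn

theorem isMultiplier_freq (hF : InPlane F) (hp1 : 1 ≤ p) {v : Plane} {σ : ℝ} (hσ : 0 < σ)
    (h : ∀ j ∈ F, |freq j v| ≤ σ) :
    IsMultiplier p F (ENNReal.ofReal (5 / 3 * σ)) fun j => (freq j v : ℂ) := by
  -- The substitution `x = θ/(4σ) + 1/4` maps `[-σ, σ]` into `[0, 1/2]`, where the wave equals
  -- `-π²θ/(8σ)`. The cost 5/4 is 1 + 1/4 from the two cosines; the term `n = 0` vanishes because `1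
  -- / 0 = 0`.
  have hw : ∀ (n : ℕ), IsMultiplier p F (ENNReal.ofReal (5 / 4 * (1 / (n : ℝ) ^ 2)))
      fun j => ((1 / (n : ℝ) ^ 2 * Real.cos (2 * Real.pi * n * (freq j v / (4 * σ) + 1 / 4)) +
        -(1 / 4) * (1 / (n : ℝ) ^ 2 *
          Real.cos (2 * Real.pi * n * (2 * (freq j v / (4 * σ) + 1 / 4)))) : ℝ) : ℂ) := by
    intro n
    have h1 := (IsMultiplier.cos_freq (p := p) hF hp1 ((2 * Real.pi * n / (4 * σ)) • v)
      (2 * Real.pi * n / 4)).const_smul ((1 / (n : ℝ) ^ 2 : ℝ) : ℂ)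
    have h2 := (IsMultiplier.cos_freq (p := p) hF hp1 ((2 * Real.pi * n * 2 / (4 * σ)) • v)
      (2 * Real.pi * n * 2 / 4)).const_smul ((-(1 / 4) * (1 / (n : ℝ) ^ 2) : ℝ) : ℂ)
    refine ((h1.add hF hp1 h2).congr fun j _ => ?_).mono ?_
    · simp only [Pi.add_apply, Pi.smul_apply, smul_eq_mul, ← Complex.ofReal_mul,
        ← Complex.ofReal_add, freq_smul]
      ring_nf
    · rw [mul_one, mul_one, ← ofReal_norm, ← ofReal_norm, ← ENNReal.ofReal_add (norm_nonneg _)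
        (norm_nonneg _), Complex.norm_real, Complex.norm_real, Real.norm_eq_abs, Real.norm_eq_abs,
        abs_mul, abs_of_nonneg (by positivity : 0 ≤ 1 / (n : ℝ) ^ 2)]
      apply ENNReal.ofReal_le_ofReal
      rw [abs_neg, abs_of_nonneg (by norm_num : (0 : ℝ) ≤ 1 / 4)]
      linarith
  have hsum : ∀ N : ℕ, IsMultiplier p F (ENNReal.ofReal (5 / 4 * (Real.pi ^ 2 / 6)))
      (∑ n ∈ Finset.range N, fun j => _) := fun N =>
    (IsMultiplier.sum hF hp1 (Finset.range N) fun n _ => hw n).mono (by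
      rw [← ENNReal.ofReal_sum_of_nonneg (fun _ _ => by positivity), ← Finset.mul_sum]
      gcongr
      exact sum_le_hasSum _ (fun _ _ => by positivity) hasSum_zeta_two)
  have hlim := (IsMultiplier.of_tendsto
    (m := fun j => ((Real.pi ^ 2 * (1 / 8 - (freq j v / (4 * σ) + 1 / 4) / 2) : ℝ) : ℂ))
    hF hp1 hsum fun j hj => by
      have hb := abs_le.1 (h j hj)
      have hx : freq j v / (4 * σ) + 1 / 4 ∈ Set.Icc (0 : ℝ) (1 / 2) := by
        have : |freq j v / (4 * σ)| ≤ 1 / 4 := by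
          rw [abs_div, abs_of_pos (by positivity : 0 < 4 * σ), div_le_iff₀ (by positivity)]
          linarith [h j hj]
        rw [abs_le] at this
        constructor <;> linarith
      have := (hasSum_triangle_wave hx).tendsto_sum_nat
      have := (Complex.continuous_ofReal.tendsto _).comp this
      simpa only [Function.comp_def, Finset.sum_apply, Complex.ofReal_sum] using this)
  -- Rescaling by `-8σ/π²` recovers `θ`, at total cost `(8σ/π²) · (5/4) · (π²/6) = 5σ/3`.
  refine ((hlim.const_smul ((-(8 * σ / Real.pi ^ 2) : ℝ) : ℂ)).congr fun j _ => ?_).mono ?_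
  · simp only [Pi.smul_apply, smul_eq_mul, ← Complex.ofReal_mul]
    congr 1
    field_simp
    ring
  · rw [← ofReal_norm, Complex.norm_real, norm_neg, Real.norm_of_nonneg (by positivity),
      ← ENNReal.ofReal_mul (by positivity)]
    apply ENNReal.ofReal_le_ofReal
    apply le_of_eq
    field_simp
    norm_num

theorem isMultiplier_exp_sub_one (hF : InPlane F) (hp1 : 1 ≤ p) {v : Plane} {σ : ℝ} (hσ : 0 ≤ σ)
    (h : ∀ j ∈ F, |freq j v| ≤ σ) :
    IsMultiplier p F (ENNReal.ofReal (5 / 3 * σ))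
      fun j => Complex.exp (freq j v * Complex.I) - 1 := by
  obtain rfl | hσ := hσ.eq_or_lt
  · refine (IsMultiplier.zero.congr fun j hj => ?_).mono zero_le
    have : freq j v = 0 := abs_nonpos_iff.1 (h j hj)
    simp [this]
  have hA : ∀ n : ℕ, IsMultiplier p F 1 (∑ k ∈ Finset.range n,
      (n : ℂ)⁻¹ • fun j => Complex.exp ((freq j ((k / n : ℝ) • v) : ℝ) * Complex.I)) := by
    intro n
    refine (IsMultiplier.sum hF hp1 (Finset.range n) fun k _ =>
      (IsMultiplier.exp_freq hF hp1 ((k / n : ℝ) • v)).const_smul (n : ℂ)⁻¹).mono ?_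
    rw [Finset.sum_const, Finset.card_range, mul_one, nsmul_eq_mul]
    obtain rfl | hn := eq_or_ne n 0
    · simp
    · rw [enorm_inv (by exact_mod_cast hn), ← ofReal_norm, Complex.norm_natCast,
        ENNReal.ofReal_natCast]
      exact ENNReal.mul_inv_le_one _
  have hD := (isMultiplier_freq hF hp1 hσ h).const_smul Complex.I
  refine (IsMultiplier.of_tendsto hF hp1 (fun n => hD.mul (hA n)) fun j _ => ?_).mono ?_
  · refine (tendsto_mul_average_exp (freq j v)).congr fun n => ?_
    simp only [Pi.mul_apply, Pi.smul_apply, Finset.sum_apply, smul_eq_mul, freq_smul]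
    ring
  · rw [← ofReal_norm, Complex.norm_I, ENNReal.ofReal_one, one_mul, mul_one]

end HexApprox

/-! ### Bernstein's inequality for differences -/

namespace HexApprox

variable {p : ℝ≥0∞} {f g S : Plane → ℂ} {n : ℕ}

theorem finite_hexIndex (n : ℕ) : (hexIndex n).Finite :=
  (Set.Finite.pi' fun _ : Fin 3 => Set.finite_Icc (-(n : ℤ)) n).subset fun _ hj i => hj.2 i

theorem hexIndex_mono : Monotone hexIndex := fun m n h j hj =>
  ⟨hj.1, fun i => ⟨by have := (hj.2 i).1; omega, by have := (hj.2 i).2; omega⟩⟩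

theorem trigPoly_mono : Monotone trigPoly := fun _ _ h =>
  Submodule.span_mono (Set.image_mono (hexIndex_mono h))

theorem inPlane_hexIndex (n : ℕ) : InPlane (finite_hexIndex n).toFinset := fun _ hj =>
  ((finite_hexIndex n).mem_toFinset.1 hj).1

theorem mem_trigPoly_iff : S ∈ trigPoly n ↔ ∃ c, expSum (finite_hexIndex n).toFinset c = S := by
  simpa only [Set.Finite.coe_toFinset, trigPoly, expSum] using Submodule.mem_span_image_finset_iff_exists_fun'
    (s := (finite_hexIndex n).toFinset) (v := phi) (R := ℂ) (x := S)

theorem memHexLp_of_mem_trigPoly (hS : S ∈ trigPoly n) : MemHexLp p S := by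
  obtain ⟨c, rfl⟩ := mem_trigPoly_iff.1 hS
  exact memHexLp_expSum (inPlane_hexIndex n) c

theorem fwdDiff_expSum (F : Finset (Fin 3 → ℤ)) (t : Plane) (c : (Fin 3 → ℤ) → ℂ) :
    fwdDiff t (expSum F c) =
      expSum F ((fun j => Complex.exp (freq j t * Complex.I) - 1) * c) := by
  funext x
  simp only [fwdDiff, expSum, Finset.sum_apply, Pi.smul_apply, smul_eq_mul, Pi.mul_apply, phi_add,
    ← phi_eq, ← Finset.sum_sub_distrib]
  exact Finset.sum_congr rfl fun j _ => by ring

theorem fwdDiff_mem_trigPoly (hS : S ∈ trigPoly n) (t : Plane) : fwdDiff t S ∈ trigPoly n := by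
  obtain ⟨c, rfl⟩ := mem_trigPoly_iff.1 hS
  exact mem_trigPoly_iff.2 ⟨_, (fwdDiff_expSum _ t c).symm⟩

theorem pairNorm_nonneg (t : Plane) : 0 ≤ pairNorm t := Real.sqrt_nonneg _

theorem abs_freq_le {j : Fin 3 → ℤ} (hj : j ∈ hexIndex n) (t : Plane) :
    |freq j t| ≤ 9 * (n * pairNorm t) := by
  have hb : ∀ i, |(j i : ℝ)| ≤ n := fun i => by
    rw [abs_le]
    exact ⟨by exact_mod_cast (hj.2 i).1, by exact_mod_cast (hj.2 i).2⟩
  have h0 : |t.1 0| ≤ pairNorm t := Real.abs_le_sqrt (le_add_of_nonneg_right (sq_nonneg _))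
  have h1 : |t.1 1| ≤ pairNorm t := Real.abs_le_sqrt (le_add_of_nonneg_left (sq_nonneg _))
  have hd : ∀ i, |(j i : ℝ) - j 2| ≤ 2 * n := fun i => by
    linarith [abs_sub (j i : ℝ) (j 2), hb i, hb 2]
  -- Eliminating the third coordinate leaves two terms, each at most `2n ‖t‖`. The constant 9 is
  -- this 4 times `9/4 ≥ 2π/3`; then `9 · 5/3 = 15` in Bernstein's inequality.
  have e : ∑ i, (j i : ℝ) * t.1 i = (j 0 - j 2) * t.1 0 + (j 1 - j 2) * t.1 1 := by
    rw [Fin.sum_univ_three, plane_coord_two]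
    ring
  have hs : |∑ i, (j i : ℝ) * t.1 i| ≤ 4 * (n * pairNorm t) := by
    rw [e]
    refine (abs_add_le _ _).trans ?_
    rw [abs_mul, abs_mul]
    have k0 := mul_le_mul (hd 0) h0 (abs_nonneg _) (by positivity)
    have k1 := mul_le_mul (hd 1) h1 (abs_nonneg _) (by positivity)
    linarith
  rw [freq, abs_mul, abs_of_nonneg (by positivity)]
  have hπ : 2 * Real.pi / 3 ≤ 9 / 4 := by linarith [Real.pi_lt_d2]
  refine (mul_le_mul hπ hs (abs_nonneg _) (by norm_num)).trans_eq ?_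
  ring

/-- Bernstein's inequality for differences of trigonometric polynomials. -/
theorem hexNorm_fwdDiff_le (hp1 : 1 ≤ p) (hS : S ∈ trigPoly n) (t : Plane) :
    hexNorm p (fwdDiff t S) ≤ ENNReal.ofReal (15 * (n * pairNorm t)) * hexNorm p S := by
  obtain ⟨c, rfl⟩ := mem_trigPoly_iff.1 hS
  have := isMultiplier_exp_sub_one (p := p) (inPlane_hexIndex n) hp1 (v := t)
    (mul_nonneg (by norm_num) (mul_nonneg n.cast_nonneg (pairNorm_nonneg t)))
    (fun j hj => abs_freq_le ((finite_hexIndex n).mem_toFinset.1 hj) t) c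
  rw [fwdDiff_expSum]
  convert this using 3
  ring

theorem hexNorm_fwdDiff_iterate_le (hp1 : 1 ≤ p) (hS : S ∈ trigPoly n) (t : Plane) (r : ℕ) :
    hexNorm p ((fwdDiff t)^[r] S) ≤
      ENNReal.ofReal (15 * (n * pairNorm t)) ^ r * hexNorm p S := by
  suffices h : (fwdDiff t)^[r] S ∈ trigPoly n ∧ hexNorm p ((fwdDiff t)^[r] S) ≤
      ENNReal.ofReal (15 * (n * pairNorm t)) ^ r * hexNorm p S from h.2
  induction r with
  | zero => simpa using hS
  | succ r ih =>
    rw [Function.iterate_succ_apply', pow_succ', mul_assoc]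
    exact ⟨fwdDiff_mem_trigPoly ih.1 t,
      (hexNorm_fwdDiff_le hp1 ih.1 t).trans (mul_le_mul_right ih.2 _)⟩

theorem fwdDiff_eq_translate (t : Plane) (f : Plane → ℂ) :
    fwdDiff t f = translate t f + (-1 : ℂ) • f := by
  funext x
  simp only [fwdDiff, translate, Pi.add_apply, Pi.smul_apply, smul_eq_mul, add_comm t x]
  ring

theorem MemHexLp.fwdDiff (hf : MemHexLp p f) (hp1 : 1 ≤ p) (t : Plane) :
    MemHexLp p (fwdDiff t f) := by
  rw [fwdDiff_eq_translate]
  exact (hf.translate hp1 t).add (hf.const_smul _)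

theorem MemHexLp.fwdDiff_iterate (hf : MemHexLp p f) (hp1 : 1 ≤ p) (t : Plane) (r : ℕ) :
    MemHexLp p ((_root_.fwdDiff t)^[r] f) := by
  induction r with
  | zero => exact hf
  | succ r ih =>
    rw [Function.iterate_succ_apply']
    exact ih.fwdDiff hp1 t

theorem hexNorm_fwdDiff_iterate_le_two_pow (hf : MemHexLp p f) (hp1 : 1 ≤ p) (t : Plane) (r : ℕ) :
    hexNorm p ((fwdDiff t)^[r] f) ≤ 2 ^ r * hexNorm p f := by
  induction r with
  | zero => simp
  | succ r ih =>
    have hm := hf.fwdDiff_iterate hp1 t r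
    rw [Function.iterate_succ_apply', fwdDiff_eq_translate]
    refine (hexNorm_add_le (hm.translate hp1 t) (hm.const_smul _) hp1).trans ?_
    rw [hexNorm_translate hm hp1, hexNorm_const_smul, enorm_neg, enorm_one, one_mul, ← two_mul,
      pow_succ', mul_assoc]
    exact mul_le_mul_right ih _

theorem MemHexLp.sub (hf : MemHexLp p f) (hg : MemHexLp p g) : MemHexLp p (f - g) := by
  have := hf.add (hg.const_smul (-1))
  rwa [neg_one_smul, ← sub_eq_add_neg] at this

theorem hexNorm_sub_comm (f g : Plane → ℂ) : hexNorm p (f - g) = hexNorm p (g - f) := by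
  rw [← neg_sub, ← neg_one_smul ℂ, hexNorm_const_smul, enorm_neg, enorm_one, one_mul]

theorem hexNorm_fwdDiff_iterate_le_add (hf : MemHexLp p f) (hg : MemHexLp p g) (hp1 : 1 ≤ p)
    (t : Plane) (r : ℕ) : hexNorm p ((fwdDiff t)^[r] f) ≤
      hexNorm p ((fwdDiff t)^[r] (f - g)) + hexNorm p ((fwdDiff t)^[r] g) := by
  have := fwdDiff_iter_add t (f - g) g r
  rw [sub_add_cancel] at this
  rw [this]
  exact hexNorm_add_le ((hf.sub hg).fwdDiff_iterate hp1 t r) (hg.fwdDiff_iterate hp1 t r) hp1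

/-! ### Dyadic decomposition and condensation -/

theorem bestApprox_antitone (p : ℝ≥0∞) (f : Plane → ℂ) : Antitone fun n => bestApprox n p f :=
  fun _ _ h => biInf_mono fun _ hS => trigPoly_mono h hS

theorem exists_hexNorm_sub_le (n : ℕ) (p : ℝ≥0∞) (f : Plane → ℂ) {ε : ℝ≥0∞} (hε : ε ≠ 0) :
    ∃ S ∈ trigPoly n, hexNorm p (f - S) ≤ bestApprox n p f + ε := by
  by_cases h : bestApprox n p f = ∞
  · exact ⟨0, zero_mem _, by simp [h]⟩
  · have hlt := ENNReal.lt_add_right h hε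
    nth_rewrite 1 [bestApprox] at hlt
    simp only [iInf_lt_iff, exists_prop] at hlt
    obtain ⟨S, hS, hlt⟩ := hlt
    exact ⟨S, hS, hlt.le⟩

/-- Cauchy condensation with polynomial weights. -/
theorem dyadic_sum_le {e : ℕ → ℝ≥0∞} (he : Antitone e) {r : ℕ} (hr : 1 ≤ r) (k : ℕ) :
    e 0 + ∑ j ∈ Finset.range (k + 1), (2 : ℝ≥0∞) ^ (j * r) * e (2 ^ j) ≤
      2 ^ r * ∑ n ∈ Finset.range (2 ^ k + 1), ((n : ℝ≥0∞) + 1) ^ (r - 1) * e n := by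
  induction k with
  | zero =>
    simp only [zero_add, pow_zero, zero_mul, one_mul, Finset.sum_range_one, Nat.cast_zero, one_pow,
      Finset.sum_range_succ _ 1, Nat.cast_one]
    have h : e 0 + e 1 ≤ e 0 + (1 + 1) ^ (r - 1) * e 1 := by
      gcongr
      exact le_mul_of_one_le_left' (one_le_pow₀ (by norm_num))
    exact h.trans (le_mul_of_one_le_left' (one_le_pow₀ one_le_two))
  | succ k ih =>
    rw [Finset.sum_range_succ, ← add_assoc]
    have hsplit : 2 ^ (k + 1) + 1 = 2 ^ k + 1 + 2 ^ k := by ring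
    rw [hsplit, Finset.sum_range_add _ (2 ^ k + 1), mul_add]
    refine add_le_add ih ?_
    -- The block `2^k < n ≤ 2^{k+1}` has `2^k` indices, each with weight at least `2^{k(r-1)}` and
    -- error at least `e (2^{k+1})`. The factor `2^r` then makes up exactly `2^{(k+1)r}`.
    have hterm : ∀ i ∈ Finset.range (2 ^ k), (2 : ℝ≥0∞) ^ (k * (r - 1)) * e (2 ^ (k + 1)) ≤
        (((2 ^ k + 1 + i : ℕ) : ℝ≥0∞) + 1) ^ (r - 1) * e (2 ^ k + 1 + i) := fun i hi => by
      rw [pow_mul]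
      gcongr
      · push_cast
        rw [add_assoc, add_assoc]
        exact le_self_add
      · apply he
        have := Finset.mem_range.1 hi
        omega
    have hs := Finset.sum_le_sum hterm
    rw [Finset.sum_const, Finset.card_range, nsmul_eq_mul] at hs
    refine le_trans (le_of_eq ?_) (mul_le_mul_right hs _)
    obtain ⟨s, rfl⟩ := Nat.exists_eq_add_of_le' hr
    push_cast
    ring

/-- Telescoping along `S 0, S 1, S 2, S 4, …`: each increment has norm at most twice the earlier
error, and Bernstein applies to it. The sequence `e` stands for the best errors plus a small excess,
so no best approximant needs to exist. -/
theorem hexNorm_fwdDiff_iterate_dyadic_le (hp1 : 1 ≤ p) {r : ℕ} (hr : 1 ≤ r) {h : ℝ}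
    {t : Plane} (ht : pairNorm t ≤ h) (hf : MemHexLp p f) {S : ℕ → Plane → ℂ}
    (hS : ∀ n, S n ∈ trigPoly n) {e : ℕ → ℝ≥0∞} (he : Antitone e)
    (hSe : ∀ n, hexNorm p (f - S n) ≤ e n) (k : ℕ) :
    hexNorm p ((fwdDiff t)^[r] (S (2 ^ k))) ≤ 2 * 30 ^ r * ENNReal.ofReal h ^ r *
      (e 0 + ∑ j ∈ Finset.range k, (2 : ℝ≥0∞) ^ (j * r) * e (2 ^ j)) := by
  have hm : ∀ n, MemHexLp p (S n) := fun n => memHexLp_of_mem_trigPoly (hS n)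
  have hdiff : ∀ m n, m ≤ n → hexNorm p ((fwdDiff t)^[r] (S n)) ≤
      (15 * n) ^ r * ENNReal.ofReal h ^ r * (2 * e m) + hexNorm p ((fwdDiff t)^[r] (S m)) := by
    intro m n hmn
    refine (hexNorm_fwdDiff_iterate_le_add (hm n) (hm m) hp1 t r).trans (add_le_add_left ?_ _)
    refine (hexNorm_fwdDiff_iterate_le hp1
      (sub_mem (hS n) (trigPoly_mono hmn (hS m))) t r).trans (mul_le_mul' ?_ ?_)
    · rw [← mul_pow, ← mul_assoc, ENNReal.ofReal_mul (by positivity),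
        ENNReal.ofReal_mul (by positivity), ENNReal.ofReal_natCast, ENNReal.ofReal_ofNat]
      gcongr
    · have : S n - S m = (S n - f) + (f - S m) := by abel
      rw [this, two_mul]
      refine (hexNorm_add_le ((hm n).sub hf) (hf.sub (hm m)) hp1).trans (add_le_add ?_ (hSe m))
      rw [hexNorm_sub_comm]
      exact (hSe n).trans (he hmn)
  induction k with
  | zero =>
    -- In degree 0 Bernstein's factor is `0 ^ r`, which vanishes because `r ≥ 1`.
    have h0 : hexNorm p ((fwdDiff t)^[r] (S 0)) = 0 := by
      have := hexNorm_fwdDiff_iterate_le hp1 (hS 0) t r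
      rwa [Nat.cast_zero, zero_mul, mul_zero, ENNReal.ofReal_zero,
        zero_pow (Nat.one_le_iff_ne_zero.1 hr), zero_mul, nonpos_iff_eq_zero] at this
    have := hdiff 0 1 zero_le_one
    rw [h0, add_zero, Nat.cast_one, mul_one] at this
    rw [pow_zero, Finset.sum_range_zero, add_zero]
    refine this.trans ?_
    calc (15 : ℝ≥0∞) ^ r * ENNReal.ofReal h ^ r * (2 * e 0)
        = 2 * 15 ^ r * ENNReal.ofReal h ^ r * e 0 := by ring
      _ ≤ _ := by gcongr; norm_num
  | succ k ih =>
    refine (hdiff (2 ^ k) (2 ^ (k + 1)) (Nat.pow_le_pow_right two_pos k.le_succ)).trans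
      ((add_le_add_right ih _).trans_eq ?_)
    rw [Finset.sum_range_succ]
    -- The increment ending at degree `2^{k+1}` is charged to `e (2^k)`; the extra factor 2 in the
    -- degree turns 15 into 30.
    have : (15 * ((2 ^ (k + 1) : ℕ) : ℝ≥0∞)) ^ r = 30 ^ r * 2 ^ (k * r) := by
      rw [pow_mul, ← mul_pow]
      push_cast
      ring_nf
    rw [this]
    ring

theorem hexNorm_fwdDiff_iterate_le_sum (hp1 : 1 ≤ p) {r : ℕ} (hr : 1 ≤ r) {h : ℝ} (hh : 0 < h)
    {t : Plane} (ht : pairNorm t ≤ h) (hf : MemHexLp p f) {S : ℕ → Plane → ℂ}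
    (hS : ∀ n, S n ∈ trigPoly n) {e : ℕ → ℝ≥0∞} (he : Antitone e)
    (hSe : ∀ n, hexNorm p (f - S n) ≤ e n) :
    hexNorm p ((fwdDiff t)^[r] f) ≤ 2 * 60 ^ r * ENNReal.ofReal h ^ r *
      ∑ n ∈ Finset.range (⌊1 / h⌋₊ + 1), ((n : ℝ≥0∞) + 1) ^ (r - 1) * e n := by
  have hm : ∀ n, MemHexLp p (S n) := fun n => memHexLp_of_mem_trigPoly (hS n)
  have hmain : ∀ n, hexNorm p ((fwdDiff t)^[r] f) ≤
      2 ^ r * e n + hexNorm p ((fwdDiff t)^[r] (S n)) := fun n =>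
    (hexNorm_fwdDiff_iterate_le_add hf (hm n) hp1 t r).trans (add_le_add_left
      ((hexNorm_fwdDiff_iterate_le_two_pow (hf.sub (hm n)) hp1 t r).trans
        (mul_le_mul_right (hSe n) _)) _)
  have hlt := Nat.lt_floor_add_one (1 / h)
  obtain hq | hq := Nat.eq_zero_or_pos ⌊1 / h⌋₊
  -- Here `h > 1` and the sum has only the term `n = 0`; constants already suffice.
  · rw [hq] at hlt ⊢
    have h1 : 1 ≤ ENNReal.ofReal h := by
      rw [ENNReal.one_le_ofReal]
      rw [div_lt_iff₀ hh] at hlt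
      push_cast at hlt
      linarith
    have h0 : hexNorm p ((fwdDiff t)^[r] (S 0)) = 0 := by
      have := hexNorm_fwdDiff_iterate_le hp1 (hS 0) t r
      rwa [Nat.cast_zero, zero_mul, mul_zero, ENNReal.ofReal_zero,
        zero_pow (Nat.one_le_iff_ne_zero.1 hr), zero_mul, nonpos_iff_eq_zero] at this
    have := hmain 0
    rw [h0, add_zero] at this
    simp only [zero_add, Finset.sum_range_one, Nat.cast_zero, one_pow, one_mul]
    refine this.trans (mul_le_mul_left ?_ _)
    calc (2 : ℝ≥0∞) ^ r = 1 * 2 ^ r * 1 ^ r := by ring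
      _ ≤ _ := by gcongr <;> norm_num
  · set k := Nat.log 2 ⌊1 / h⌋₊
    have hk : 2 ^ k ≤ ⌊1 / h⌋₊ := Nat.pow_log_le_self 2 hq.ne'
    have hk' : ⌊1 / h⌋₊ < 2 ^ (k + 1) := Nat.lt_pow_succ_log_self one_lt_two _
    have h1 : 1 ≤ 2 * 2 ^ k * ENNReal.ofReal h := by
      have h2 : (⌊1 / h⌋₊ : ℝ) + 1 ≤ 2 ^ (k + 1) := by exact_mod_cast hk'
      have h3 := (div_lt_iff₀ hh).1 (hlt.trans_le h2)
      have h4 : (2 : ℝ≥0∞) * 2 ^ k * ENNReal.ofReal h = ENNReal.ofReal (2 ^ (k + 1) * h) := by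
        rw [ENNReal.ofReal_mul (by positivity), ENNReal.ofReal_pow (by norm_num),
          ENNReal.ofReal_ofNat, pow_succ']
      rw [h4, ENNReal.one_le_ofReal]
      exact h3.le
    -- Since `1 ≤ 2 · 2^k · h`, the approximation error of `S (2 ^ k)` has the size of the missing
    -- term `j = k` of the dyadic sum.
    have hlast : 2 ^ r * e (2 ^ k) ≤
        2 * 30 ^ r * ENNReal.ofReal h ^ r * (2 ^ (k * r) * e (2 ^ k)) := by
      rw [← mul_assoc]
      refine mul_le_mul_left ?_ _
      calc (2 : ℝ≥0∞) ^ r = 2 ^ r * 1 ^ r := by ring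
        _ ≤ 2 ^ r * (2 * 2 ^ k * ENNReal.ofReal h) ^ r := by gcongr
        _ = 1 * (2 * 2) ^ r * ENNReal.ofReal h ^ r * 2 ^ (k * r) := by
          rw [pow_mul, mul_pow, mul_pow, mul_pow]
          ring
        _ ≤ _ := by gcongr <;> norm_num
    calc hexNorm p ((fwdDiff t)^[r] f)
        ≤ 2 ^ r * e (2 ^ k) + hexNorm p ((fwdDiff t)^[r] (S (2 ^ k))) := hmain _
      _ ≤ 2 * 30 ^ r * ENNReal.ofReal h ^ r * (2 ^ (k * r) * e (2 ^ k)) +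
          2 * 30 ^ r * ENNReal.ofReal h ^ r *
            (e 0 + ∑ j ∈ Finset.range k, (2 : ℝ≥0∞) ^ (j * r) * e (2 ^ j)) :=
        add_le_add hlast (hexNorm_fwdDiff_iterate_dyadic_le hp1 hr ht hf hS he hSe k)
      _ = 2 * 30 ^ r * ENNReal.ofReal h ^ r *
            (e 0 + ∑ j ∈ Finset.range (k + 1), (2 : ℝ≥0∞) ^ (j * r) * e (2 ^ j)) := by
        rw [Finset.sum_range_succ]
        ring
      _ ≤ 2 * 30 ^ r * ENNReal.ofReal h ^ r * (2 ^ r *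
            ∑ n ∈ Finset.range (2 ^ k + 1), ((n : ℝ≥0∞) + 1) ^ (r - 1) * e n) :=
        mul_le_mul_right (dyadic_sum_le he hr k) _
      _ = 2 * (30 * 2) ^ r * ENNReal.ofReal h ^ r *
            ∑ n ∈ Finset.range (2 ^ k + 1), ((n : ℝ≥0∞) + 1) ^ (r - 1) * e n := by
        rw [mul_pow]
        ring
      _ ≤ _ := by
        have : (30 * 2 : ℝ≥0∞) = 60 := by norm_num
        rw [this]
        gcongr

end HexApprox

open HexApprox in
theorem modulus_le_sum_bestApprox {r : ℕ} (hr : 1 ≤ r) {p : ℝ≥0∞} (hp1 : 1 ≤ p)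
    {f : Plane → ℂ} (hf : MemHexLp p f) {h : ℝ} (hh : 0 < h) :
    modulus r f h p ≤ 2 * 60 ^ r * ENNReal.ofReal h ^ r *
      ∑ n ∈ Finset.range (⌊1 / h⌋₊ + 1), ((n : ℝ≥0∞) + 1) ^ (r - 1) * bestApprox n p f := by
  refine iSup₂_le fun t ht => ?_
  -- Approximants within `1/m` of the infimum are used, and `m → ∞` removes the excess from the
  -- finite sum. At `m = 0` the excess is `∞`, which is harmless.
  have hε : ∀ m : ℕ, hexNorm p ((fwdDiff t)^[r] f) ≤ 2 * 60 ^ r * ENNReal.ofReal h ^ r *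
      ∑ n ∈ Finset.range (⌊1 / h⌋₊ + 1),
        ((n : ℝ≥0∞) + 1) ^ (r - 1) * (bestApprox n p f + (m : ℝ≥0∞)⁻¹) := fun m => by
    choose S hS hSe using fun n => exists_hexNorm_sub_le n p f
      (ENNReal.inv_ne_zero.2 (ENNReal.natCast_ne_top m))
    exact hexNorm_fwdDiff_iterate_le_sum hp1 hr hh ht hf hS
      (fun _ _ h => add_le_add_left (bestApprox_antitone p f h) _) hSe
  refine ge_of_tendsto' (x := atTop) (ENNReal.Tendsto.const_mul
    (tendsto_finsetSum _ fun n _ => ENNReal.Tendsto.const_mul ?_ (.inr ?_)) (.inr ?_)) hε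
  · simpa using tendsto_const_nhds.add ENNReal.tendsto_inv_nat_nhds_zero
  · finiteness
  · finiteness

theorem theorem4p9 (r : ℕ) (hr : 1 ≤ r) :
    ∃ c : ℝ≥0, ∀ (p : ℝ≥0∞), 1 ≤ p → ∀ f : HexApprox.Plane → ℂ, HexApprox.MemHexLp p f →
      ∀ h : ℝ, 0 < h →
        HexApprox.modulus r f h p ≤
          (c : ℝ≥0∞) * ENNReal.ofReal h ^ r *
            ∑ n ∈ Finset.range (⌊1 / h⌋₊ + 1),
              ((n : ℝ≥0∞) + 1) ^ (r - 1) * HexApprox.bestApprox n p f := by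
  refine ⟨2 * 60 ^ r, fun p hp1 f hf h hh => ?_⟩
  push_cast
  exact modulus_le_sum_bestApprox hr hp1 hf hh
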